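/- All graphs are finite, simple and undirected. For a graph $H$, a graph $G$ is $H$-free if no induced subgraph of $G$ is isomorphic to $H$, and $G$ is $(H_1,H_2)$-free if it is both $H_1$-free and $H_2$-free; $P_5$ is the path on $5$ vertices and $K_4$ is the complete graph on $4$ vertices. The game of cops and robber with $k$ cops is played on a connected graph as follows. First the cops are placed on vertices (several cops may share a vertex), then the robber chooses a vertex. Then the two sides move alternately, starting with the cops; in the cops' turn each cop stays at its vertex or moves to an adjacent vertex, and in the robber's turn the robber does likewise. All positions are known to both sides. The cops win if, after a finite number of rounds, some cop is at the same vertex as the robber. The cop number $\mathrm{cop}(G)$ of a graph $G$ is the minimum $k$ such that $k$ cops have a winning strategy in each component of $G$. **Theorem.** Let $G$ be a connected $(P_5,K_4)$-free graph. Then $\mathrm{cop}(G)\le 2$. -/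

import Mathlib

namespace CopsAndRobber

variable {V W : Type*}

/-- `G` is `H`-free: no induced subgraph of `G` is isomorphic to `H`. -/
def InducedFree (H : SimpleGraph W) (G : SimpleGraph V) : Prop :=
  ¬ H.IsIndContained G

/-- A valid move of one piece (a cop or the robber): stay, or go to an adjacent vertex. -/
def IsMove (G : SimpleGraph V) (u v : V) : Prop :=
  u = v ∨ G.Adj u v

/-- The first `n` positions `r 0, …, r (n - 1)` of the robber, the most recent one first. -/
def history (r : ℕ → V) : ℕ → List V
  | 0 => []
  | n + 1 => r n :: history r n

/-- A strategy for `k` cops on `G`. It gives the positions of the cops as a function of the list of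
the positions that the robber has taken so far (most recent first); the value at the empty list is
the initial placement. Between consecutive turns every cop makes a valid move. -/
structure CopStrategy (G : SimpleGraph V) (k : ℕ) where
  /-- the positions of the cops after the given robber history -/
  pos : List V → Fin k → V
  /-- each cop stays or moves along an edge -/
  valid : ∀ (h : List V) (v : V) (i : Fin k), IsMove G (pos h i) (pos (v :: h) i)

/-- A legal play of the robber: he chooses the vertex `r 0` after the cops are placed, and
`r (n + 1)` is his position after his move in round `n + 1`. -/
def IsRobberPlay (G : SimpleGraph V) (r : ℕ → V) : Prop :=
  ∀ n, IsMove G (r n) (r (n + 1))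

/-- In the play where the cops follow `σ` and the robber plays `r`, some cop is at some point at the
vertex of the robber: either just after the robber's turn that took him to `r n` (the cops are then
at `σ.pos (history r n)`), or just after the cops' next turn (they are then at
`σ.pos (history r (n + 1))`). -/
def Captures {G : SimpleGraph V} {k : ℕ} (σ : CopStrategy G k) (r : ℕ → V) : Prop :=
  ∃ (n : ℕ) (i : Fin k), σ.pos (history r n) i = r n ∨ σ.pos (history r (n + 1)) i = r n

/-- `k` cops win on `G`: they have a strategy that captures the robber after finitely many rounds,
whatever the robber does. -/
def CopsWin (G : SimpleGraph V) (k : ℕ) : Prop :=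
  ∃ σ : CopStrategy G k, ∀ r : ℕ → V, IsRobberPlay G r → Captures σ r

/-- The cop number: the least `k` such that `k` cops win in each component of `G`
(it would be `⊤` if there were no such `k`). -/
noncomputable def copNumber (G : SimpleGraph V) : ℕ∞ :=
  ⨅ (k : ℕ) (_ : ∀ C : G.ConnectedComponent, CopsWin C.toSimpleGraph k), (k : ℕ∞)

end CopsAndRobber

namespace CopsAndRobber

variable {V : Type*} {G : SimpleGraph V}

/-! Keep the cops on an edge `uv` and induct on the size of the robber's territory, the part
reachable from `y` while avoiding the neighbourhoods of `u` and `v`. Suppose the robber survives.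
The core claim is that no neighbour of `y` sees exactly one cop. If `y` also has a neighbour seeing
neither cop, an extremal choice of private neighbour yields a `P₅` or a `K₄` (`win_of_unguarded`).
Otherwise `y` is in a `Trap`, and another extremal choice yields an induced pentagon inside the
neighbourhood of `y`, which is impossible (`Trap.private_false`). By `P₅`-freeness the claim extends
to the whole territory: all its boundary vertices see both cops. So one cop guards the boundary
alone, and the other steps onto a boundary vertex, which shrinks the territory (`win_of_adj`). -/

theorem IsMove.refl (v : V) : IsMove G v v := Or.inl rfl

/-! ### Winning positions and strategies -/

/-- Two cops at `p` and `q`, who are to move, can capture a robber at `r`. -/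
inductive Win (G : SimpleGraph V) : V → V → V → Prop
  | step {p q r : V} (p' q' : V) (hp : IsMove G p p') (hq : IsMove G q q')
      (h : p' ≠ r → q' ≠ r → ∀ r', IsMove G r r' → Win G p' q' r') : Win G p q r

/-- Two cops at `p` and `q`, who are to move, can capture a robber at `r` within `n` rounds. -/
def WinIn (G : SimpleGraph V) : ℕ → V → V → V → Prop
  | 0, _, _, _ => False
  | n + 1, p, q, r => ∃ p' q', IsMove G p p' ∧ IsMove G q q' ∧
      (p' ≠ r → q' ≠ r → ∀ r', IsMove G r r' → WinIn G n p' q' r')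

theorem WinIn.succ {n : ℕ} : ∀ {p q r : V}, WinIn G n p q r → WinIn G (n + 1) p q r := by
  induction n with
  | zero => exact fun h => h.elim
  | succ n ih =>
    rintro p q r ⟨p', q', hp, hq, h⟩
    exact ⟨p', q', hp, hq, fun h₁ h₂ r' hr => ih (h h₁ h₂ r' hr)⟩

theorem WinIn.mono {m n : ℕ} (hmn : m ≤ n) {p q r : V} (h : WinIn G m p q r) :
    WinIn G n p q r := by
  induction hmn with
  | refl => exact h
  | step _ ih => exact ih.succ

theorem Win.exists_winIn [Finite V] {p q r : V} (h : Win G p q r) : ∃ n, WinIn G n p q r := by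
  induction h with
  | @step p q r p' q' hp hq _ ih =>
    by_cases hc : p' ≠ r ∧ q' ≠ r
    · choose! f hf using ih hc.1 hc.2
      -- Finiteness of `V` bounds the number of rounds uniformly over the robber's replies.
      obtain ⟨N, hN⟩ := (Set.finite_range f).bddAbove
      exact ⟨N + 1, p', q', hp, hq, fun _ _ r' hr =>
        (hf r' hr).mono (hN (Set.mem_range_self r'))⟩
    · exact ⟨1, p', q', hp, hq, fun h₁ h₂ => (hc ⟨h₁, h₂⟩).elim⟩

/-- There is a single move that is good whatever the number of rounds that is needed. -/
theorem exists_move (G : SimpleGraph V) (p q r : V) : ∃ p' q', IsMove G p p' ∧ IsMove G q q' ∧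
    ∀ n, WinIn G (n + 1) p q r → ¬ WinIn G n p q r →
      p' ≠ r → q' ≠ r → ∀ r', IsMove G r r' → WinIn G n p' q' r' := by
  by_cases h : ∃ n, WinIn G (n + 1) p q r ∧ ¬ WinIn G n p q r
  · obtain ⟨n, ⟨p', q', hp, hq, h⟩, hn⟩ := h
    refine ⟨p', q', hp, hq, fun m hm hm' => ?_⟩
    have h₁ : n ≤ m := by
      by_contra hlt
      exact hn (hm.mono (by omega))
    have h₂ : m ≤ n := by
      by_contra hlt
      exact hm' (WinIn.mono (m := n + 1) (by omega) ⟨p', q', hp, hq, h⟩)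
    obtain rfl := le_antisymm h₁ h₂
    exact h
  · exact ⟨p, q, .refl p, .refl q, fun n h₁ h₂ => (h ⟨n, h₁, h₂⟩).elim⟩

/-- The moves of `exists_move` depend only on the position, and each one lowers the least number of
rounds still needed. -/
theorem copsWin_two [Finite V] (p₀ q₀ : V) (h : ∀ r, Win G p₀ q₀ r) : CopsWin G 2 := by
  choose f g hf hg hfg using exists_move G
  let st : List V → V × V := fun l =>
    List.rec (p₀, q₀) (fun r _ s => (f s.1 s.2 r, g s.1 s.2 r)) l
  have st_cons (r : V) (l : List V) :
      st (r :: l) = (f (st l).1 (st l).2 r, g (st l).1 (st l).2 r) := rfl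
  refine ⟨⟨fun l => ![(st l).1, (st l).2], fun l v i => ?_⟩, fun r hr => ?_⟩
  · fin_cases i
    · exact hf _ _ _
    · exact hg _ _ _
  · have key (n : ℕ) : ∀ k, WinIn G n (st (history r k)).1 (st (history r k)).2 (r k) →
        ∃ k, (st (history r (k + 1))).1 = r k ∨ (st (history r (k + 1))).2 = r k := by
      induction n with
      | zero => exact fun k h => h.elim
      | succ n ih =>
        intro k hk
        by_cases hn : WinIn G n (st (history r k)).1 (st (history r k)).2 (r k)
        · exact ih k hn
        · by_contra hc
          push Not at hc
          exact (hc _).1 (ih (k + 1) (hfg _ _ _ n hk hn (hc k).1 (hc k).2 _ (hr k))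
            |>.choose_spec.resolve_right (hc _).2)
    obtain ⟨n, hn⟩ := (h (r 0)).exists_winIn
    obtain ⟨k, hk⟩ := key n 0 hn
    rcases hk with hk | hk
    · exact ⟨k, 0, Or.inr hk⟩
    · exact ⟨k, 1, Or.inr hk⟩

theorem Win.symm {p q r : V} (h : Win G p q r) : Win G q p r := by
  induction h with
  | step p' q' hp hq _ ih => exact .step q' p' hq hp fun h₁ h₂ => ih h₂ h₁

theorem Win.of_isMove_left {p q r : V} (h : IsMove G p r) : Win G p q r :=
  .step r q h (.refl q) fun h => (h rfl).elim

theorem Win.of_isMove_right {p q r : V} (h : IsMove G q r) : Win G p q r :=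
  (Win.of_isMove_left h).symm

/-- If the cops cannot win, then the robber has an answer to each of their moves. -/
theorem exists_escape {p q r : V} (h : ¬ Win G p q r) {p' q' : V} (hp : IsMove G p p')
    (hq : IsMove G q q') : ∃ r', IsMove G r r' ∧ ¬ Win G p' q' r' ∧
      p' ≠ r' ∧ q' ≠ r' ∧ ¬ G.Adj p' r' ∧ ¬ G.Adj q' r' := by
  by_contra hc
  push Not at hc
  refine h (.step p' q' hp hq fun _ _ r' hr => ?_)
  by_contra hw
  by_cases h₁ : IsMove G p' r'
  · exact hw (.of_isMove_left h₁)
  by_cases h₂ : IsMove G q' r'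
  · exact hw (.of_isMove_right h₂)
  unfold IsMove at h₁ h₂
  push Not at h₁ h₂
  exact h₂.2 (hc r' hr hw h₁.1 h₂.1 h₁.2)

/-! ### Forbidden induced subgraphs -/

/-- The five-vertex path is not an induced subgraph. -/
def NoPath (G : SimpleGraph V) : Prop :=
  ∀ a b c d e, G.Adj a b → G.Adj b c → G.Adj c d → G.Adj d e → ¬ G.Adj a c → ¬ G.Adj a d →
    ¬ G.Adj a e → ¬ G.Adj b d → ¬ G.Adj b e → ¬ G.Adj c e → False

/-- There are no four pairwise adjacent vertices. -/
def NoClique (G : SimpleGraph V) : Prop :=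
  ∀ a b c d, G.Adj a b → G.Adj a c → G.Adj a d → G.Adj b c → G.Adj b d → G.Adj c d → False

theorem InducedFree.noPath (h : InducedFree (SimpleGraph.pathGraph 5) G) : NoPath G := by
  intro a b c d e ab bc cd de ac ad ae bd be ce
  have key : ∀ i j : Fin 5, G.Adj (![a, b, c, d, e] i) (![a, b, c, d, e] j) ↔
      (SimpleGraph.pathGraph 5).Adj i j := by
    intro i j
    rw [SimpleGraph.pathGraph_adj]
    fin_cases i <;> fin_cases j <;> simp [*, G.adj_comm]
  refine h ⟨⟨⟨![a, b, c, d, e], fun i j hij => ?_⟩, key _ _⟩⟩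
  have hi (k : Fin 5) := (key i k).symm.trans (hij ▸ key j k)
  simp only [SimpleGraph.pathGraph_adj] at hi
  revert hi
  clear hij
  revert i j
  decide

theorem InducedFree.noClique (h : InducedFree (⊤ : SimpleGraph (Fin 4)) G) : NoClique G := by
  intro a b c d ab ac ad bc bd cd
  have key : ∀ i j : Fin 4, i ≠ j → G.Adj (![a, b, c, d] i) (![a, b, c, d] j) := by
    intro i j hij
    fin_cases i <;> fin_cases j <;> first | exact (hij rfl).elim | assumption | exact SimpleGraph.Adj.symm (by assumption)
  have hinj : Function.Injective ![a, b, c, d] := fun i j hij => by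
    by_contra hne
    exact (key i j hne).ne hij
  exact h ⟨⟨⟨_, hinj⟩, ⟨fun hij => fun hne => hij.ne (congrArg _ hne), fun hij => key _ _ hij⟩⟩⟩

theorem NoPath.elim (h : NoPath G) (a b c d e : V)
    (ab : G.Adj a b := by first | assumption | (rw [SimpleGraph.adj_comm]; assumption))
    (bc : G.Adj b c := by first | assumption | (rw [SimpleGraph.adj_comm]; assumption))
    (cd : G.Adj c d := by first | assumption | (rw [SimpleGraph.adj_comm]; assumption))
    (de : G.Adj d e := by first | assumption | (rw [SimpleGraph.adj_comm]; assumption))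
    (ac : ¬ G.Adj a c := by first | assumption | (rw [SimpleGraph.adj_comm]; assumption))
    (ad : ¬ G.Adj a d := by first | assumption | (rw [SimpleGraph.adj_comm]; assumption))
    (ae : ¬ G.Adj a e := by first | assumption | (rw [SimpleGraph.adj_comm]; assumption))
    (bd : ¬ G.Adj b d := by first | assumption | (rw [SimpleGraph.adj_comm]; assumption))
    (be : ¬ G.Adj b e := by first | assumption | (rw [SimpleGraph.adj_comm]; assumption))
    (ce : ¬ G.Adj c e := by first | assumption | (rw [SimpleGraph.adj_comm]; assumption)) :
    False :=
  h a b c d e ab bc cd de ac ad ae bd be ce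

/-- Let `u` and `v` be adjacent. If a vertex `t` that is adjacent to neither of them is adjacent to
a private neighbour of `u`, then it is adjacent to each private neighbour of `v` that is not
adjacent to the former. -/
theorem NoPath.adj_of_adj (hP : NoPath G) {u v a b t : V} (huv : G.Adj u v) (ua : G.Adj u a)
    (va : ¬ G.Adj v a) (vb : G.Adj v b) (ub : ¬ G.Adj u b) (ab : ¬ G.Adj a b)
    (ut : ¬ G.Adj u t) (vt : ¬ G.Adj v t) (ta : G.Adj t a) : G.Adj t b := by
  by_contra tb
  exact hP.elim t a u v b

/-- Two disjoint edges between the private neighbourhoods of `u` and `v` are joined by an edge. -/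
theorem NoPath.joined (hP : NoPath G) {v a b a' b' : V} (vb : G.Adj v b)
    (vb' : G.Adj v b') (va : ¬ G.Adj v a) (va' : ¬ G.Adj v a') (ab : G.Adj a b)
    (ab' : G.Adj a' b') (aa : ¬ G.Adj a a') (bb : ¬ G.Adj b b') (h₁ : ¬ G.Adj a b')
    (h₂ : ¬ G.Adj a' b) : False :=
  hP.elim a b v b' a'

/-! ### Robber with all neighbours guarded -/

/-- The cops are at adjacent vertices `u` and `v`, all neighbours of the robber's vertex `y` are
adjacent to `u` or `v`, and the robber is safe. -/
structure Trap (G : SimpleGraph V) (u v y : V) : Prop where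
  adj : G.Adj u v
  left : ¬ G.Adj u y
  right : ¬ G.Adj v y
  guarded : ∀ t, G.Adj y t → G.Adj u t ∨ G.Adj v t
  not_win : ¬ Win G u v y

namespace Trap

variable {u v y : V}

theorem symm (h : Trap G u v y) : Trap G v u y :=
  ⟨h.adj.symm, h.right, h.left, fun t ht => (h.guarded t ht).symm, fun hw => h.not_win hw.symm⟩

/-- The robber's reply when the cops shift along `u`, `v`, `x`. -/
theorem exists_left (h : Trap G u v y) {x : V} (vx : G.Adj v x) (yx : G.Adj y x) :
    ∃ w, G.Adj y w ∧ G.Adj u w ∧ ¬ G.Adj v w ∧ ¬ G.Adj x w ∧ ¬ Win G v x w := by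
  obtain ⟨w, hw, hnw, -, -, vw, xw⟩ := exists_escape h.not_win (Or.inr h.adj) (Or.inr vx)
  rcases hw with rfl | hw
  · exact (xw yx.symm).elim
  · exact ⟨w, hw, (h.guarded w hw).resolve_right vw, vw, xw, hnw⟩

/-- Two successive replies: `z` when the cop at `v` goes to `g`, then `w` when the cop at `u` goes
to `v`. If `u` does not see `w`, a reply from `exists_left` replaces it. -/
theorem exists_edge (h : Trap G u v y) (hP : NoPath G) {g : V} (vg : G.Adj v g)
    (ug : ¬ G.Adj u g) (yg : G.Adj y g) :
    ∃ z w, G.Adj y z ∧ G.Adj v z ∧ ¬ G.Adj u z ∧ ¬ G.Adj g z ∧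
      G.Adj y w ∧ G.Adj u w ∧ ¬ G.Adj v w ∧ ¬ G.Adj g w ∧ G.Adj z w := by
  have huv := h.adj
  have uy := h.left
  have vy := h.right
  obtain ⟨z, hz, hnz, -, -, uz, gz⟩ := exists_escape h.not_win (.refl u) (Or.inr vg)
  have yz : G.Adj y z := hz.resolve_left (by rintro rfl; exact gz yg.symm)
  have vz := (h.guarded z yz).resolve_left uz
  obtain ⟨w, hw, -, -, -, vw, gw⟩ := exists_escape hnz (Or.inr huv) (.refl g)
  have zw : G.Adj z w := hw.resolve_left (by rintro rfl; exact vw vz)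
  by_cases uw : G.Adj u w
  · exact ⟨z, w, yz, vz, uz, gz, hP.adj_of_adj huv.symm vg ug uw vw gw vy uy yg, uw, vw, gw, zw⟩
  · obtain ⟨a, ya, ua, va, ga, -⟩ := h.exists_left vg yg
    by_cases za : G.Adj z a
    · exact ⟨z, a, yz, vz, uz, gz, ya, ua, va, ga, za⟩
    · have wa := hP.adj_of_adj huv.symm vz uz ua va za vw uw zw.symm
      have wg := hP.adj_of_adj huv ua va vg ug (fun h => ga h.symm) uw vw wa
      exact (gw wg.symm).elim

/-! ### Excluding a pentagon around the robber -/

section Pentagon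

variable {q₀ q₁ q₂ q₃ q₄ r : V}

/-- Here `r` answers the cops' move to `v`, `q₁`. They next go to `u`, `q₀`, and every possible
reply `s` creates a `P₅` or a `K₄`. -/
theorem pentagon_aux (h : Trap G u v y) (hP : NoPath G) (hK : NoClique G)
    (y0 : G.Adj y q₀) (y1 : G.Adj y q₁) (y2 : G.Adj y q₂) (y3 : G.Adj y q₃) (y4 : G.Adj y q₄)
    (h01 : G.Adj q₀ q₁) (h12 : G.Adj q₁ q₂) (h23 : G.Adj q₂ q₃) (h34 : G.Adj q₃ q₄)
    (h40 : G.Adj q₄ q₀) (h02 : ¬ G.Adj q₀ q₂) (h03 : ¬ G.Adj q₀ q₃) (h13 : ¬ G.Adj q₁ q₃)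
    (h14 : ¬ G.Adj q₁ q₄) (h24 : ¬ G.Adj q₂ q₄)
    (u0 : G.Adj u q₀) (v0 : ¬ G.Adj v q₀) (u1 : ¬ G.Adj u q₁) (v1 : G.Adj v q₁)
    (v2 : ¬ G.Adj v q₂) (u3 : ¬ G.Adj u q₃) (v3 : G.Adj v q₃) (v4 : G.Adj v q₄)
    (yr : G.Adj y r) (ur : G.Adj u r) (vr : ¬ G.Adj v r) (r1 : ¬ G.Adj q₁ r)
    (hr : ¬ Win G v q₁ r) (r0 : ¬ G.Adj q₀ r) : False := by
  have huv := h.adj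
  have uy := h.left
  have vy := h.right
  have r3 : ¬ G.Adj r q₃ := by
    intro r3
    have r4 : ¬ G.Adj r q₄ := fun r4 => hK y r q₃ q₄ yr y3 y4 r3 r4 h34
    exact hP.elim r q₃ q₄ q₀ q₁
  obtain ⟨s, hs, -, -, -, us, s0⟩ := exists_escape hr (Or.inr huv.symm) (Or.inr h01.symm)
  have rs : G.Adj r s := hs.resolve_left (by rintro rfl; exact us ur)
  by_cases vs : G.Adj v s
  · have ys : G.Adj y s := hP.adj_of_adj huv u0 v0 vs us s0 uy vy y0
    have s1 : G.Adj s q₁ := by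
      by_contra s1
      exact hP.joined (v := v) vs v1 vr v0 rs h01 (fun h => r0 h.symm) s1 (fun h => r1 h.symm) s0
    have s2 : ¬ G.Adj s q₂ := fun s2 => hK y s q₁ q₂ ys y1 y2 s1 s2 h12
    by_cases r4 : G.Adj r q₄
    · have s4 : ¬ G.Adj s q₄ := fun s4 => hK y r s q₄ yr ys y4 rs r4 s4
      by_cases s3 : G.Adj s q₃
      · exact hP.elim u q₀ q₁ s q₃
      · exact hP.elim s q₁ q₀ q₄ q₃
    · have s4 : G.Adj s q₄ := by
        by_contra s4
        exact hP.joined (v := v) vs v4 vr v0 rs h40.symm (fun h => r0 h.symm) s4 r4 s0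
      have s3 : ¬ G.Adj s q₃ := fun s3 => hK y s q₃ q₄ ys y3 y4 s3 s4 h34
      by_cases r2 : G.Adj r q₂
      · exact hP.elim r q₂ q₃ q₄ q₀
      · exact hP.joined (v := v) vs v3 vr v2 rs h23 r2 s3 r3 (fun h => s2 h.symm)
  · have s3 := hP.adj_of_adj huv ur vr v3 u3 r3 us vs rs.symm
    have s0' := hP.adj_of_adj huv.symm v3 u3 u0 v0 (fun h => h03 h.symm) vs us s3
    exact s0 s0'.symm

theorem pentagon (h : Trap G u v y) (hP : NoPath G) (hK : NoClique G)
    (y0 : G.Adj y q₀) (y1 : G.Adj y q₁) (y2 : G.Adj y q₂) (y3 : G.Adj y q₃) (y4 : G.Adj y q₄)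
    (h01 : G.Adj q₀ q₁) (h12 : G.Adj q₁ q₂) (h23 : G.Adj q₂ q₃) (h34 : G.Adj q₃ q₄)
    (h40 : G.Adj q₄ q₀) (h02 : ¬ G.Adj q₀ q₂) (h03 : ¬ G.Adj q₀ q₃) (h13 : ¬ G.Adj q₁ q₃)
    (h14 : ¬ G.Adj q₁ q₄) (h24 : ¬ G.Adj q₂ q₄)
    (u0 : G.Adj u q₀) (v0 : ¬ G.Adj v q₀) (u1 : ¬ G.Adj u q₁) (v1 : G.Adj v q₁)
    (u2 : G.Adj u q₂) (v2 : ¬ G.Adj v q₂) (u3 : ¬ G.Adj u q₃) (v3 : G.Adj v q₃)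
    (u4 : ¬ G.Adj u q₄) (v4 : G.Adj v q₄) : False := by
  obtain ⟨r, yr, ur, vr, r1, hr⟩ := h.exists_left v1 y1
  by_cases r0 : G.Adj q₀ r
  · by_cases r2 : G.Adj q₂ r
    · have r3 : ¬ G.Adj q₃ r := fun r3 => hK y r q₂ q₃ yr y2 y3 r2.symm r3.symm h23
      exact hP.elim v q₃ q₂ r q₀
    -- Reflect the pentagon in the axis through `q₁`.
    · exact h.pentagon_aux hP hK y2 y1 y0 y4 y3 h12.symm h01.symm h40.symm h34.symm h23.symm
        (fun h => h02 h.symm) h24 h14 h13 h03 u2 v2 u1 v1 v0 u4 v4 v3 yr ur vr r1 hr r2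
  · exact h.pentagon_aux hP hK y0 y1 y2 y3 y4 h01 h12 h23 h34 h40 h02 h03 h13 h14 h24
      u0 v0 u1 v1 v2 u3 v3 v4 yr ur vr r1 hr r0

end Pentagon

/-! ### Extremal choice of a private neighbour -/

/-- The neighbours of `y` that are adjacent to exactly one of `u` and `v`. -/
def privateNbrs (G : SimpleGraph V) (u v y : V) : Set V :=
  {t | G.Adj y t ∧ (G.Adj u t ∧ ¬ G.Adj v t ∨ G.Adj v t ∧ ¬ G.Adj u t)}

theorem privateNbrs_comm (G : SimpleGraph V) (u v y : V) :
    privateNbrs G u v y = privateNbrs G v u y := by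
  ext t
  exact and_congr_right fun _ => or_comm

/-- The private neighbours of `v` that have a neighbour among the private neighbours of `u`. -/
def Crosses (G : SimpleGraph V) (u v y x : V) : Prop :=
  G.Adj y x ∧ G.Adj v x ∧ ¬ G.Adj u x ∧ ∃ s, G.Adj y s ∧ G.Adj u s ∧ ¬ G.Adj v s ∧ G.Adj x s

/-- The number of neighbours in `privateNbrs G u v y`. -/
noncomputable def privateDegree (G : SimpleGraph V) (u v y x : V) : ℕ :=
  {t | t ∈ privateNbrs G u v y ∧ G.Adj x t}.ncard

theorem exists_not_adj_of_degree_le [Finite V] {x z t : V} (ht : t ∈ privateNbrs G u v y)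
    (zt : G.Adj z t) (xt : ¬ G.Adj x t) (hle : privateDegree G u v y z ≤ privateDegree G u v y x) :
    ∃ t' ∈ privateNbrs G u v y, G.Adj x t' ∧ ¬ G.Adj z t' := by
  by_contra hc
  push Not at hc
  refine hle.not_gt (Set.ncard_lt_ncard ⟨fun t' ht' => ⟨ht'.1, hc t' ht'.1 ht'.2⟩, fun hsub => ?_⟩
    (Set.toFinite _))
  exact xt (hsub ⟨ht, zt⟩).2

/-- `exists_edge` gives an edge `zw` missing `x`. Comparing degrees of `x` with `z` and with `w`
gives neighbours `t`, `t'` of `x` making `x t w z t'` an induced pentagon, whose sides are then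
examined. -/
theorem false_of_max [Finite V] (h : Trap G u v y) (hP : NoPath G) (hK : NoClique G) {x : V}
    (hx : Crosses G u v y x)
    (hmax : ∀ z, Crosses G u v y z ∨ Crosses G v u y z →
      privateDegree G u v y z ≤ privateDegree G u v y x) : False := by
  have huv := h.adj
  obtain ⟨yx, vx, ux, s, ys, us, vs, xs⟩ := hx
  obtain ⟨z, w, yz, vz, uz, xz, yw, uw, vw, xw, zw⟩ := h.exists_edge hP vx ux yx
  obtain ⟨t, ⟨yt, ht⟩, xt, zt⟩ := exists_not_adj_of_degree_le
    (t := w) ⟨yw, Or.inl ⟨uw, vw⟩⟩ zw xw (hmax z (Or.inl ⟨yz, vz, uz, w, yw, uw, vw, zw⟩))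
  obtain ⟨t', ⟨yt', ht'⟩, xt', wt'⟩ := exists_not_adj_of_degree_le
    (t := z) ⟨yz, Or.inr ⟨vz, uz⟩⟩ zw.symm xz
    (hmax w (Or.inr ⟨yw, uw, vw, z, yz, vz, uz, zw.symm⟩))
  have wt : G.Adj w t := by
    by_contra wt
    rcases ht with ⟨ut, vt⟩ | ⟨vt, ut⟩
    · exact hP.elim t x v z w
    -- With `t` and `x` both on the side of `v`, the neighbour `s` of `x` on the side of `u` is what
    -- produces the path.
    · have st : ¬ G.Adj s t := fun st => hK y x s t yx ys yt xs xt st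
      by_cases sw : G.Adj s w
      · have sz : ¬ G.Adj s z := fun sz => hK y s w z ys yw yz sw sz zw.symm
        exact hP.elim t x s w z
      · by_cases sz : G.Adj s z
        · exact hP.elim t x s z w
        · exact hP.elim s x v z w
  have tt' : ¬ G.Adj t t' := fun tt' => hK y x t t' yx yt yt' xt xt' tt'
  have zt' : G.Adj z t' := by
    by_contra zt'
    exact hP.elim t' x t w z
  have zx : ¬ G.Adj z x := fun h => xz h.symm
  have wx : ¬ G.Adj w x := fun h => xw h.symm
  have t't : ¬ G.Adj t' t := fun h => tt' h.symm
  rcases ht' with ⟨ut', vt'⟩ | ⟨vt', ut'⟩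
  · rcases ht with ⟨ut, vt⟩ | ⟨vt, ut⟩
    · exact h.symm.pentagon hP hK yz yt' yx yt yw zt' xt'.symm xt wt.symm zw.symm
        zx zt t't (fun h => wt' h.symm) xw vz uz vt' ut' vx ux vt ut vw uw
    · exact h.pentagon hP hK yw yz yt' yx yt zw.symm zt' xt'.symm xt wt.symm
        wt' wx zx zt t't uw vw uz vz ut' vt' ux vx ut vt
  · exact hP.elim u w z t' x

theorem private_false [Finite V] (h : Trap G u v y) (hP : NoPath G) (hK : NoClique G) {x : V}
    (yx : G.Adj y x) (vx : G.Adj v x) (ux : ¬ G.Adj u x) : False := by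
  obtain ⟨z, w, yz, vz, uz, -, yw, uw, vw, -, zw⟩ := h.exists_edge hP vx ux yx
  obtain ⟨x, hx, hmax⟩ := Set.exists_max_image
    {x | Crosses G u v y x ∨ Crosses G v u y x} (privateDegree G u v y) (Set.toFinite _)
    ⟨z, Or.inl ⟨yz, vz, uz, w, yw, uw, vw, zw⟩⟩
  rcases hx with hx | hx
  · exact h.false_of_max hP hK hx hmax
  · refine h.symm.false_of_max hP hK hx fun z hz => ?_
    have := hmax z hz.symm
    simpa only [privateDegree, privateNbrs_comm G u v y] using this

end Trap

/-! ### Unguarded neighbours and shrinking the territory -/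

section Main

variable {u v y : V}

/-- The cops win if the robber's vertex has a private neighbour of `v` and a neighbour that is
adjacent to neither cop. -/
theorem win_of_unguarded [Finite V] (hP : NoPath G) (hK : NoClique G) (huv : G.Adj u v)
    (uy : ¬ G.Adj u y) (vy : ¬ G.Adj v y) {x y' : V} (yx : G.Adj y x) (vx : G.Adj v x)
    (ux : ¬ G.Adj u x) (yy' : G.Adj y y') (uy' : ¬ G.Adj u y') (vy' : ¬ G.Adj v y') :
    Win G u v y := by
  have propagate {x c c' : V} (vx : G.Adj v x) (ux : ¬ G.Adj u x) (xc : G.Adj x c)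
      (uc : ¬ G.Adj u c) (vc : ¬ G.Adj v c) (cc' : G.Adj c c') (uc' : ¬ G.Adj u c')
      (vc' : ¬ G.Adj v c') : G.Adj x c' := by
    by_contra xc'
    exact hP.elim u v x c c'
  by_contra hw
  obtain ⟨x, ⟨yx, vx, ux⟩, hmax⟩ := Set.exists_max_image
    {x | G.Adj y x ∧ G.Adj v x ∧ ¬ G.Adj u x}
    (fun x => {t | G.Adj x t ∧ ¬ G.Adj u t ∧ ¬ G.Adj v t}.ncard) (Set.toFinite _) ⟨x, yx, vx, ux⟩
  have xy' := propagate vx ux yx.symm uy vy yy' uy' vy'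
  obtain ⟨z, hz, hnz, -, -, uz, xz⟩ := exists_escape hw (.refl u) (Or.inr vx)
  have yz : G.Adj y z := hz.resolve_left (by rintro rfl; exact xz yx.symm)
  have vz : G.Adj v z := by
    by_contra vz
    exact xz (propagate vx ux yx.symm uy vy yz uz vz)
  have zy' := propagate vz uz yz.symm uy vy yy' uy' vy'
  obtain ⟨w, hw, -, -, -, vw, xw⟩ := exists_escape hnz (Or.inr huv) (.refl x)
  have zw : G.Adj z w := hw.resolve_left (by rintro rfl; exact vw vz)
  by_cases uw : G.Adj u w
  · have yw := hP.adj_of_adj huv.symm vx ux uw vw xw vy uy yx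
    have y'w := hP.adj_of_adj huv.symm vx ux uw vw xw vy' uy' xy'.symm
    exact hK y y' z w yy' yz yw zy'.symm y'w zw
  -- `w` counts for `z` but not for `x`, so by maximality some `w'` counts for `x` but not for `z`.
  · obtain ⟨w', ⟨xw', uw', vw'⟩, zw'⟩ : ∃ w', (G.Adj x w' ∧ ¬ G.Adj u w' ∧ ¬ G.Adj v w') ∧
        ¬ G.Adj z w' := by
      by_contra hc
      push Not at hc
      refine (hmax z ⟨yz, vz, uz⟩).not_gt
        (Set.ncard_lt_ncard ⟨fun t ht => ⟨hc t ht, ht.2⟩, fun hsub => ?_⟩ (Set.toFinite _))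
      exact xw (hsub ⟨zw, uw, vw⟩).1
    by_cases ww' : G.Adj w' w
    · exact xw (propagate vx ux xw' uw' vw' ww' uw vw)
    · exact hP.elim w' x v z w

/-- The robber's territory when he is at `y` and the cops stay at `u` and `v`. -/
def territory (G : SimpleGraph V) (u v y : V) : Set V :=
  {c | Relation.ReflTransGen (fun a b => G.Adj a b ∧ ¬ G.Adj u b ∧ ¬ G.Adj v b) y c}

theorem not_adj_of_mem_territory (uy : ¬ G.Adj u y) (vy : ¬ G.Adj v y) {c : V}
    (hc : c ∈ territory G u v y) : ¬ G.Adj u c ∧ ¬ G.Adj v c := by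
  induction hc with
  | refl => exact ⟨uy, vy⟩
  | tail _ h _ => exact h.2

/-- Adjacency to `x` passes back along the robber's walk, else `u v x c b` is an induced `P₅`. -/
theorem adj_of_adj_territory (hP : NoPath G) (huv : G.Adj u v) (uy : ¬ G.Adj u y)
    (vy : ¬ G.Adj v y) {x c : V} (vx : G.Adj v x) (ux : ¬ G.Adj u x)
    (hc : c ∈ territory G u v y) (cx : G.Adj c x) : G.Adj y x := by
  induction hc with
  | refl => exact cx
  | @tail b c hb h ih =>
    obtain ⟨bc, uc, vc⟩ := h
    obtain ⟨ub, vb⟩ := not_adj_of_mem_territory uy vy hb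
    refine ih ?_
    by_contra bx
    exact hP.elim u v x c b

theorem win_of_adj [Finite V] (hconn : G.Connected) (hP : NoPath G) (hK : NoClique G) (n : ℕ) :
    ∀ u v y, G.Adj u v → (territory G u v y).ncard ≤ n → Win G u v y := by
  induction n with
  | zero =>
    intro u v y _ hn
    rw [Nat.le_zero, Set.ncard_eq_zero] at hn
    exact (hn ▸ (Relation.ReflTransGen.refl : y ∈ territory G u v y) : y ∈ (∅ : Set V)).elim
  | succ n ih =>
    intro u v y huv hn
    by_contra hw
    have uy : ¬ G.Adj u y := fun h => hw (.of_isMove_left (Or.inr h))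
    have vy : ¬ G.Adj v y := fun h => hw (.of_isMove_right (Or.inr h))
    have hyC : y ∈ territory G u v y := Relation.ReflTransGen.refl
    have key : ∀ u v, G.Adj u v → ¬ Win G u v y → ¬ G.Adj u y → ¬ G.Adj v y →
        ∀ x, G.Adj y x → G.Adj v x → ¬ G.Adj u x → False := by
      intro u v huv hw uy vy x yx vx ux
      by_cases hg : ∀ t, G.Adj y t → G.Adj u t ∨ G.Adj v t
      · exact Trap.private_false ⟨huv, uy, vy, hg, hw⟩ hP hK yx vx ux
      · push Not at hg
        obtain ⟨y', yy', uy', vy'⟩ := hg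
        exact hw (win_of_unguarded hP hK huv uy vy yx vx ux yy' uy' vy')
    have key' : ∀ c ∈ territory G u v y, ∀ x, G.Adj c x → (G.Adj u x ↔ G.Adj v x) := by
      intro c hc x cx
      by_contra hx
      by_cases ux : G.Adj u x
      · have vx : ¬ G.Adj v x := fun vx => hx ⟨fun _ => vx, fun _ => ux⟩
        have hc' : c ∈ territory G v u y := by
          simpa only [territory, and_comm (a := ¬ G.Adj u _)] using hc
        exact key v u huv.symm (fun h => hw h.symm) vy uy x
          (adj_of_adj_territory hP huv.symm vy uy ux vx hc' cx) ux vx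
      · have vx : G.Adj v x := by
          by_contra vx
          exact hx ⟨fun h => (ux h).elim, fun h => (vx h).elim⟩
        exact key u v huv hw uy vy x (adj_of_adj_territory hP huv uy vy vx ux hc cx) vx ux
    have hu : u ∉ territory G u v y := fun h =>
      (not_adj_of_mem_territory uy vy h).2 huv.symm
    obtain ⟨p⟩ := hconn.preconnected y u
    obtain ⟨⟨⟨c, d⟩, cd⟩, -, hc, hd⟩ := p.exists_boundary_dart _ hyC hu
    have hcd : G.Adj c d := cd
    have ud : G.Adj u d := by
      by_contra ud
      exact hd (Relation.ReflTransGen.tail hc ⟨hcd, ud, mt (key' c hc d hcd).2 ud⟩)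
    -- The cop at `v` steps onto the boundary vertex `d`; the cop at `u` still guards the boundary.
    obtain ⟨r, hr, hnr, -, -, ur, dr⟩ :=
      exists_escape hw (.refl u) (Or.inr ((key' c hc d hcd).1 ud))
    have hrC : r ∈ territory G u v y := by
      rcases hr with rfl | hr
      · exact hyC
      · exact Relation.ReflTransGen.single ⟨hr, ur, mt (key' y hyC r hr).2 ur⟩
    refine hnr (ih u d r ud (Nat.le_of_lt_succ (lt_of_lt_of_le
      (Set.ncard_lt_ncard ⟨fun b hb => ?_, fun hsub => ?_⟩ (Set.toFinite _)) hn)))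
    · induction hb with
      | refl => exact hrC
      | @tail a b _ h ih =>
        exact Relation.ReflTransGen.tail ih ⟨h.1, h.2.1, mt (key' a ih b h.1).2 h.2.1⟩
    -- `c` leaves the territory because `d` now sees it.
    · exact (not_adj_of_mem_territory ur dr (hsub hc)).2 hcd.symm

end Main

theorem copsWin_two_of_connected [Finite V] (hconn : G.Connected) (hP : NoPath G)
    (hK : NoClique G) : CopsWin G 2 := by
  obtain ⟨u⟩ := hconn.nonempty
  by_cases h : ∃ v, G.Adj u v
  · obtain ⟨v, huv⟩ := h
    exact copsWin_two u v fun r => win_of_adj hconn hP hK _ u v r huv le_rfl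
  · refine copsWin_two u u fun r => .of_isMove_left (Or.inl ?_)
    by_contra hne
    have : Nontrivial V := ⟨u, r, hne⟩
    exact h (hconn.preconnected.exists_adj_of_nontrivial u)

theorem InducedFree.of_embedding {W V' : Type*} {H : SimpleGraph W} {G' : SimpleGraph V'}
    (f : G' ↪g G) (h : InducedFree H G) : InducedFree H G' :=
  fun ⟨g⟩ => h ⟨f.comp g⟩

end CopsAndRobber

theorem mainTheorem1 {V : Type*} [Finite V] (G : SimpleGraph V) (hconn : G.Connected)
    (hP5 : CopsAndRobber.InducedFree (SimpleGraph.pathGraph 5) G)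
    (hK4 : CopsAndRobber.InducedFree (⊤ : SimpleGraph (Fin 4)) G) :
    CopsAndRobber.copNumber G ≤ 2 := by
  refine iInf₂_le_of_le 2 (fun C => ?_) le_rfl
  have f : C.toSimpleGraph ↪g G := SimpleGraph.Embedding.induce _
  exact CopsAndRobber.copsWin_two_of_connected C.connected_toSimpleGraph
    (hP5.of_embedding f).noPath (hK4.of_embedding f).noClique
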